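/- A $2$-dimensional VASS $\mathcal V=(Q,\Sigma,\Delta,I,F)$ consists of a finite set $Q$ of states, a finite alphabet $\Sigma$, a finite set $\Delta\subseteq Q\times(\Sigma\cup\{\varepsilon\})\times\mathbb Z^2\times Q$ of transitions, and sets $I,F\subseteq Q$ of initial and final states. A configuration $q(\vec u)$ consists of $q\in Q$ and $\vec u\in\mathbb N^2$, and $q(\vec u)\le q'(\vec u')$ means $q=q'$ and $\vec u\le\vec u'$ componentwise. For a transition $t=(q,a,\vec v,q')$ we write $q(\vec u)\xrightarrow{t}q'(\vec u+\vec v)$ whenever $\vec u,\vec u+\vec v\in\mathbb N^2$. A run is a finite sequence $(c_0,t_1,c_1)(c_1,t_2,c_2)\cdots(c_{n-1},t_n,c_n)$ with $n\ge 0$, $t_i\in\Delta$ and $c_{i-1}\xrightarrow{t_i}c_i$ for all $i$, where $c_0=q_0(\vec 0)$ with $q_0\in I$ and $c_n=q_f(\vec 0)$ with $q_f\in F$. For runs $\rho=(c_0,t_1,c_1)\cdots(c_{n-1},t_n,c_n)$ and $\sigma=(c'_0,t'_1,c'_1)\cdots(c'_{m-1},t'_m,c'_m)$ write $\rho\trianglelefteq\sigma$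 if there is a strictly monotone map $f:[1,n]\to[1,m]$ with $c_{i-1}\le c'_{f(i)-1}$, $t_i=t'_{f(i)}$ and $c_i\le c'_{f(i)}$ for all $i$. A run $\rho$ is minimal if every run $\sigma\trianglelefteq\rho$ satisfies $\rho\trianglelefteq\sigma$. A basis is a finite set $B$ of runs such that every run $\sigma$ satisfies $\rho\trianglelefteq\sigma$ for some $\rho\in B$. A two-counter machine $\mathcal A=(Q,q_0,\Delta,q_f)$ consists of a finite set $Q$ of states, $q_0,q_f\in Q$, and a finite set $\Delta\subseteq Q\times(\mathbb Z^2\cup\{\mathsf{zero}_1,\mathsf{zero}_2\})\times Q$. Its configurations are pairs in $Q\times\mathbb N^2$; a transition $(p,\vec u,q)$ adds $\vec u$ to the counters, which must stay in $\mathbb N$, and $(p,\mathsf{zero}_i,q)$ is enabled only if counter $i$ is zero and leaves the counters unchanged. It has a run if $(q_f,0,0)$ is reachable from $(q_0,0,0)$. Let $\mathcal V_{\mathcal A}$ be the $2$-dimensional VASS with state set $Q$, alphabet $\{z_1,z_2\}$, initial state $q_0$, final state $q_f$, a transition $(p,\varepsilon,\vec u,q)$ for every $(p,\vec u,q)\in\Delta$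 and a transition $(p,z_i,(0,0),q)$ for every $(p,\mathsf{zero}_i,q)\in\Delta$. A run of $\mathcal V_{\mathcal A}$ is faithful if each of its transitions labelled $z_i$ is executed in a configuration whose $i$-th counter is zero, for $i=1,2$. Then the following hold. 1. For every $2$-dimensional VASS, the relation $\trianglelefteq$ on its runs is a partial order and a well-quasi-order, and the set of minimal runs is finite and is a basis. 2. For every two-counter machine $\mathcal A$: $\mathcal A$ has a run if and only if $\mathcal V_{\mathcal A}$ has a faithful run, and $\mathcal V_{\mathcal A}$ has a faithful run if and only if one of its minimal runs is faithful. 3. There is no algorithm that, given a $2$-dimensional VASS, computes a basis of its set of runs. 4. There is no algorithm that, given a $2$-dimensional VASS, computes its set of minimal runs. -/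

import Mathlib

/-- A transition `(q, a, v, q')` of a `d`-dimensional VASS: source state, label (`none` is the empty
word, `some a` is the letter `a`), counter update, target state. States and letters are named by
natural numbers, so that VASS and their runs can be handed to algorithms. -/
abbrev VASSTransition (d : ℕ) : Type := ℕ × Option ℕ × (Fin d → ℤ) × ℕ

/-- A configuration `q(u)`: a state together with the values of the `d` counters. -/
abbrev VASSConfig (d : ℕ) : Type := ℕ × (Fin d → ℕ)

/-- A finite sequence of steps `(c, t, c')`. -/
abbrev VASSStepSeq (d : ℕ) : Type := List (VASSConfig d × VASSTransition d × VASSConfig d)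

/-- A `d`-dimensional labelled vector addition system with states. -/
structure VASS (d : ℕ) where
  states : Finset ℕ
  letters : Finset ℕ
  trans : Finset (VASSTransition d)
  initial : Finset ℕ
  accepting : Finset ℕ
  trans_mem : ∀ q a v q', (q, a, v, q') ∈ trans →
    q ∈ states ∧ (∀ x, a = some x → x ∈ letters) ∧ q' ∈ states
  initial_subset : initial ⊆ states
  accepting_subset : accepting ⊆ states

/-- `c` fires `t` and becomes `c'`; the counters of both configurations are natural numbers. -/
def VASSFires {d : ℕ} (c : VASSConfig d) (t : VASSTransition d) (c' : VASSConfig d) : Prop :=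
  c.1 = t.1 ∧ c'.1 = t.2.2.2 ∧ ∀ i, (c'.2 i : ℤ) = (c.2 i : ℤ) + t.2.2.1 i

/-- Componentwise order on configurations with equal states. -/
def VASSConfigLE {d : ℕ} (c c' : VASSConfig d) : Prop :=
  c.1 = c'.1 ∧ ∀ i, c.2 i ≤ c'.2 i

/-- Order on steps `(c, t, c')`: product of the order on configurations, equality of transitions
and the order on configurations. -/
def VASSStepLE {d : ℕ} (s s' : VASSConfig d × VASSTransition d × VASSConfig d) : Prop :=
  VASSConfigLE s.1 s'.1 ∧ s.2.1 = s'.2.1 ∧ VASSConfigLE s.2.2 s'.2.2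

/-- The run embedding: a strictly monotone map of positions under which each step is
below its image. -/
def VASSEmbeds {d : ℕ} (ρ σ : VASSStepSeq d) : Prop :=
  ∃ f : Fin ρ.length → Fin σ.length, StrictMono f ∧
    ∀ i, VASSStepLE (ρ.get i) (σ.get (f i))

namespace VASS

variable {d : ℕ}

/-- `V.IsPath c ρ c'`: the steps of `ρ` are steps of `V` and lead, one after the other, from
`c` to `c'`. -/
def IsPath (V : VASS d) : VASSConfig d → VASSStepSeq d → VASSConfig d → Prop
  | c, [], c' => c = c'
  | c, s :: ρ, c' =>
      s.1 = c ∧ s.2.1 ∈ V.trans ∧ VASSFires s.1 s.2.1 s.2.2 ∧ V.IsPath s.2.2 ρ c'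

/-- A run leads from an initial to an accepting state, with all counters zero at both ends. -/
def IsRun (V : VASS d) (ρ : VASSStepSeq d) : Prop :=
  ∃ q₀ ∈ V.initial, ∃ q₁ ∈ V.accepting, V.IsPath (q₀, fun _ => 0) ρ (q₁, fun _ => 0)

/-- A run is minimal if no run lies strictly below it in the run embedding. -/
def IsMinimalRun (V : VASS d) (ρ : VASSStepSeq d) : Prop :=
  V.IsRun ρ ∧ ∀ σ, V.IsRun σ → VASSEmbeds σ ρ → VASSEmbeds ρ σ

/-- A basis of the set of runs: a finite set of runs such that every run embeds one of them. -/
def IsBasis (V : VASS d) (B : Set (VASSStepSeq d)) : Prop :=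
  B.Finite ∧ (∀ ρ ∈ B, V.IsRun ρ) ∧ ∀ σ, V.IsRun σ → ∃ ρ ∈ B, VASSEmbeds ρ σ

end VASS

/-- The input format of algorithms on VASS: lists of the states, the letters, the transitions,
the initial states and the accepting states. -/
abbrev VASSDescription (d : ℕ) : Type :=
  List ℕ × List ℕ × List (VASSTransition d) × List ℕ × List ℕ

/-- The lists in `c` enumerate the components of `V`, in any order. -/
def VASS.IsDescribedBy {d : ℕ} (V : VASS d) (c : VASSDescription d) : Prop :=
  c.1.toFinset = V.states ∧ c.2.1.toFinset = V.letters ∧ c.2.2.1.toFinset = V.trans ∧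
    c.2.2.2.1.toFinset = V.initial ∧ c.2.2.2.2.toFinset = V.accepting

/-- A two-counter machine. The operation `Sum.inl v` adds `v` to the counters, and `Sum.inr i`
tests counter `i` for zero. -/
structure TwoCounterMachine where
  states : Finset ℕ
  start : ℕ
  trans : Finset (ℕ × ((Fin 2 → ℤ) ⊕ Fin 2) × ℕ)
  target : ℕ
  start_mem : start ∈ states
  trans_mem : ∀ q o q', (q, o, q') ∈ trans → q ∈ states ∧ q' ∈ states
  target_mem : target ∈ states

namespace TwoCounterMachine

/-- One step of the machine, on configurations with natural-number counters. -/
def Step (M : TwoCounterMachine) (c c' : ℕ × (Fin 2 → ℕ)) : Prop :=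
  (∃ v : Fin 2 → ℤ, (c.1, Sum.inl v, c'.1) ∈ M.trans ∧
    ∀ i, (c'.2 i : ℤ) = (c.2 i : ℤ) + v i) ∨
  (∃ i : Fin 2, (c.1, Sum.inr i, c'.1) ∈ M.trans ∧ c.2 i = 0 ∧ c'.2 = c.2)

/-- The machine has a run from its start state to its target state, with both counters zero at
both ends. -/
def HasRun (M : TwoCounterMachine) : Prop :=
  Relation.ReflTransGen M.Step (M.start, fun _ => 0) (M.target, fun _ => 0)

/-- The VASS transition for a transition of the machine: updates get the empty label, and a test
of counter `i` becomes a transition that leaves the counters unchanged and reads the letter `i`. -/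
def toVASSTransition (t : ℕ × ((Fin 2 → ℤ) ⊕ Fin 2) × ℕ) : VASSTransition 2 :=
  match t.2.1 with
  | Sum.inl v => (t.1, none, v, t.2.2)
  | Sum.inr i => (t.1, some i.val, fun _ => 0, t.2.2)

/-- The 2-dimensional VASS that ignores the zero tests of the machine but reads the letter `i`
where the machine tests counter `i`. -/
def toVASS (M : TwoCounterMachine) : VASS 2 where
  states := M.states
  letters := {0, 1}
  trans := M.trans.image toVASSTransition
  initial := {M.start}
  accepting := {M.target}
  trans_mem := by
    intro q a v q' h
    obtain ⟨⟨p, o, p'⟩, ht, he⟩ := Finset.mem_image.1 h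
    have hs := M.trans_mem p o p' ht
    rcases o with w | i
    · simp only [toVASSTransition, Prod.mk.injEq] at he
      obtain ⟨rfl, rfl, rfl, rfl⟩ := he
      exact ⟨hs.1, by simp, hs.2⟩
    · simp only [toVASSTransition, Prod.mk.injEq] at he
      obtain ⟨rfl, rfl, rfl, rfl⟩ := he
      refine ⟨hs.1, ?_, hs.2⟩
      intro x hx
      obtain rfl := Option.some.inj hx
      fin_cases i <;> simp
  initial_subset := by simpa using M.start_mem
  accepting_subset := by simpa using M.target_mem

end TwoCounterMachine

/-- Every transition of `ρ` that reads the letter `i` is executed in a configuration whose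
counter `i` is zero. -/
def VASSFaithful (ρ : VASSStepSeq 2) : Prop :=
  ∀ s ∈ ρ, ∀ i : Fin 2, s.2.1.2.1 = some i.val → s.1.2 i = 0

/-!
Two runs are compared by a subsequence order over the order on steps. A step of a fixed VASS is
determined by one of finitely many transitions and two vectors of natural numbers, so steps are
well-quasi-ordered by Dickson's lemma, and runs by Higman's lemma
(`VASS.wellQuasiOrdered_embeds`). Since the order is well founded and antichains are finite, the
minimal runs form a finite basis. A run of the VASS of a two-counter machine is faithful exactly if
it is a run of the machine, and faithfulness passes to smaller runs (`VASSFaithful.of_embeds`).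

Because the run order is antisymmetric, every basis contains all minimal runs. Hence an algorithm
computing bases would decide whether a two-counter machine has a run: search the basis for a
faithful run. It remains to see that this problem is undecidable, on a family of machines whose
descriptions are computable.

The family consists of one fixed list of instructions `L`, preceded by a single transition that
writes `2 ^ n` to counter `0` (`CounterInstr.inputMachine`), so computability of the descriptions
only concerns that one vector. Every partial recursive function is computed by a structured register
program (`RegProg.computes_of_partrec'`), and such programs are compiled to two counters through the
Gödel number `∏ pᵢ ^ r i` of the registers (`RegProg.Exec.reach_compile`). Both steps are only
shown for computations that terminate. This is enough: if the function takes the value `0`, the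
machine reaches its target; if it takes the value `1`, the machine gets stuck elsewhere, and since
it is deterministic it has no run (`exists_code_of_partrec`). Applied to the function that runs the
program number `n` on input `n`, a decision procedure for having a run would, as a program run on
its own number, contradict itself (`exists_code_not_computablePred`).
-/

/-! ### The run embedding as a well-quasi-order -/

theorem VASSConfigLE.refl {d : ℕ} (c : VASSConfig d) : VASSConfigLE c c :=
  ⟨rfl, fun _ => le_rfl⟩

theorem VASSConfigLE.trans {d : ℕ} {c₁ c₂ c₃ : VASSConfig d} (h : VASSConfigLE c₁ c₂)
    (h' : VASSConfigLE c₂ c₃) : VASSConfigLE c₁ c₃ :=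
  ⟨h.1.trans h'.1, fun i => (h.2 i).trans (h'.2 i)⟩

theorem VASSConfigLE.antisymm {d : ℕ} {c c' : VASSConfig d} (h : VASSConfigLE c c')
    (h' : VASSConfigLE c' c) : c = c' :=
  Prod.ext h.1 (funext fun i => le_antisymm (h.2 i) (h'.2 i))

instance VASSStepLE.isPreorder {d : ℕ} :
    IsPreorder (VASSConfig d × VASSTransition d × VASSConfig d) VASSStepLE where
  refl _ := ⟨.refl _, rfl, .refl _⟩
  trans _ _ _ h h' := ⟨h.1.trans h'.1, h.2.1.trans h'.2.1, h.2.2.trans h'.2.2⟩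

theorem VASSStepLE.antisymm {d : ℕ} {s s' : VASSConfig d × VASSTransition d × VASSConfig d}
    (h : VASSStepLE s s') (h' : VASSStepLE s' s) : s = s' :=
  Prod.ext (h.1.antisymm h'.1) (Prod.ext h.2.1 (h.2.2.antisymm h'.2.2))

theorem VASSEmbeds.refl {d : ℕ} (ρ : VASSStepSeq d) : VASSEmbeds ρ ρ :=
  ⟨id, strictMono_id, fun _ => refl_of VASSStepLE _⟩

theorem VASSEmbeds.trans {d : ℕ} {ρ σ τ : VASSStepSeq d} (h : VASSEmbeds ρ σ)
    (h' : VASSEmbeds σ τ) : VASSEmbeds ρ τ := by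
  obtain ⟨f, hf, hle⟩ := h
  obtain ⟨g, hg, hle'⟩ := h'
  exact ⟨g ∘ f, hg.comp hf, fun i => trans_of VASSStepLE (hle i) (hle' (f i))⟩

theorem VASSEmbeds.length_le {d : ℕ} {ρ σ : VASSStepSeq d} (h : VASSEmbeds ρ σ) :
    ρ.length ≤ σ.length := by
  obtain ⟨f, hf, -⟩ := h
  simpa using Fintype.card_le_of_injective f hf.injective

theorem Fin.val_eq_of_strictMono {n m : ℕ} (h : n = m) (f : Fin n → Fin m) (hf : StrictMono f)
    (i : Fin n) : (f i : ℕ) = i := by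
  subst h
  exact le_antisymm (hf.apply_le (x := i)) (hf.le_apply (x := i))

theorem VASSEmbeds.getElem_le {d : ℕ} {ρ σ : VASSStepSeq d} (h : VASSEmbeds ρ σ)
    (hl : ρ.length = σ.length) (i : ℕ) (hi : i < ρ.length) :
    VASSStepLE ρ[i] (σ[i]'(hl ▸ hi)) := by
  obtain ⟨f, hf, hle⟩ := h
  have := hle ⟨i, hi⟩
  simpa [Fin.val_eq_of_strictMono hl f hf] using this

/-- Sequences that embed into each other have the same length, so both embeddings are the identity
on positions. -/
theorem VASSEmbeds.antisymm {d : ℕ} {ρ σ : VASSStepSeq d} (h : VASSEmbeds ρ σ)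
    (h' : VASSEmbeds σ ρ) : ρ = σ := by
  have hl := le_antisymm h.length_le h'.length_le
  exact List.ext_getElem hl fun i hi hi' =>
    (h.getElem_le hl i hi).antisymm (h'.getElem_le hl.symm i hi')

theorem VASSEmbeds.of_sublistForall₂ {d : ℕ} {ρ σ : VASSStepSeq d}
    (h : List.SublistForall₂ VASSStepLE ρ σ) : VASSEmbeds ρ σ := by
  obtain ⟨l, hl, hs⟩ := List.sublistForall₂_iff.1 h
  obtain ⟨f, hf⟩ := List.sublist_iff_exists_fin_orderEmbedding_get_eq.1 hs
  refine ⟨fun i => f (Fin.cast hl.length_eq i), fun i j hij => f.strictMono (by simpa using hij),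
    fun i => ?_⟩
  rw [← hf]
  exact hl.get i.2 (hl.length_eq ▸ i.2)

namespace VASS

variable {d : ℕ}

/-- A step of `V`: the transition belongs to `V` and the source configuration fires it. -/
def IsStep (V : VASS d) (s : VASSConfig d × VASSTransition d × VASSConfig d) : Prop :=
  s.2.1 ∈ V.trans ∧ VASSFires s.1 s.2.1 s.2.2

theorem IsPath.isStep {V : VASS d} {c c' : VASSConfig d} {ρ : VASSStepSeq d}
    (h : V.IsPath c ρ c') : ∀ s ∈ ρ, V.IsStep s := by
  induction ρ generalizing c with
  | nil => simp
  | cons s ρ ih =>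
    intro s' hs'
    rcases List.mem_cons.1 hs' with rfl | hs'
    · exact ⟨h.2.1, h.2.2.1⟩
    · exact ih h.2.2.2 s' hs'

/-- Dickson's lemma for steps: a step is determined up to finitely many choices by its two vectors
of counters, since its transition fixes both states. -/
theorem partiallyWellOrderedOn_isStep (V : VASS d) :
    {s | V.IsStep s}.PartiallyWellOrderedOn VASSStepLE := by
  refine Set.partiallyWellOrderedOn_iff_exists_lt.2 fun f hf => ?_
  have hpi : WellQuasiOrdered (fun u v : Fin d → ℕ => ∀ i, u i ≤ v i) :=
    WellQuasiOrdered.pi fun _ => wellQuasiOrdered_le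
  have : IsPreorder (Fin d → ℕ) (fun u v => ∀ i, u i ≤ v i) :=
    { refl := fun _ _ => le_rfl, trans := fun _ _ _ h h' i => (h i).trans (h' i) }
  have heq : WellQuasiOrdered (fun t t' : V.trans => t = t') := Finite.wellQuasiOrdered _
  obtain ⟨m, n, hmn, ht, hu, hu'⟩ := heq.prod (hpi.prod hpi)
    fun n => (⟨(f n).2.1, (hf n).1⟩, (f n).1.2, (f n).2.2.2)
  have ht' : (f m).2.1 = (f n).2.1 := congrArg Subtype.val ht
  have hm := (hf m).2
  have hn := (hf n).2
  refine ⟨m, n, hmn, ⟨?_, hu⟩, ht', ?_, hu'⟩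
  · rw [hm.1, hn.1, ht']
  · rw [hm.2.1, hn.2.1, ht']

instance isPartialOrder_embeds (V : VASS d) :
    IsPartialOrder {ρ : VASSStepSeq d // V.IsRun ρ} (fun ρ σ => VASSEmbeds ρ.1 σ.1) where
  refl ρ := .refl ρ.1
  trans _ _ _ h h' := h.trans h'
  antisymm _ _ h h' := Subtype.ext (h.antisymm h')

/-- Higman's lemma over the well-quasi-order of steps. -/
theorem wellQuasiOrdered_embeds (V : VASS d) :
    WellQuasiOrdered (fun ρ σ : {ρ : VASSStepSeq d // V.IsRun ρ} => VASSEmbeds ρ.1 σ.1) := by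
  intro f
  have := V.partiallyWellOrderedOn_isStep.partiallyWellOrderedOn_sublistForall₂ VASSStepLE
  obtain ⟨m, n, hmn, h⟩ := this.exists_lt (f := fun n => (f n).1) fun n => by
    obtain ⟨_, _, _, _, h⟩ := (f n).2
    exact h.isStep
  exact ⟨m, n, hmn, .of_sublistForall₂ h⟩

theorem exists_isMinimalRun_embeds (V : VASS d) {σ : VASSStepSeq d} (hσ : V.IsRun σ) :
    ∃ ρ, V.IsMinimalRun ρ ∧ VASSEmbeds ρ σ := by
  let r := fun ρ σ : {ρ : VASSStepSeq d // V.IsRun ρ} => VASSEmbeds ρ.1 σ.1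
  have hwf : WellFounded fun a b => r a b ∧ ¬ r b a := V.wellQuasiOrdered_embeds.wellFounded
  obtain ⟨ρ, hρ, hmin⟩ := hwf.has_min {ρ | VASSEmbeds ρ.1 σ} ⟨⟨σ, hσ⟩, .refl σ⟩
  refine ⟨ρ.1, ⟨ρ.2, fun τ hτ hτρ => ?_⟩, hρ⟩
  by_contra hn
  exact hmin ⟨τ, hτ⟩ (hτρ.trans hρ) ⟨hτρ, hn⟩

theorem finite_setOf_isMinimalRun (V : VASS d) : {ρ | V.IsMinimalRun ρ}.Finite := by
  have hanti : IsAntichain (fun ρ σ : {ρ : VASSStepSeq d // V.IsRun ρ} => VASSEmbeds ρ.1 σ.1)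
      {ρ | V.IsMinimalRun ρ.1} := fun ρ hρ σ hσ hne h =>
    hne (Subtype.ext (h.antisymm (hσ.2 ρ.1 ρ.2 h)))
  refine ((hanti.finite_of_wellQuasiOrdered V.wellQuasiOrdered_embeds).image Subtype.val).subset ?_
  exact fun ρ hρ => ⟨⟨ρ, hρ.1⟩, hρ, rfl⟩

theorem isBasis_setOf_isMinimalRun (V : VASS d) : V.IsBasis {ρ | V.IsMinimalRun ρ} :=
  ⟨V.finite_setOf_isMinimalRun, fun _ h => h.1, fun _ h => V.exists_isMinimalRun_embeds h⟩

theorem IsBasis.mem_of_isMinimalRun {V : VASS d} {B : Set (VASSStepSeq d)} (hB : V.IsBasis B)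
    {ρ : VASSStepSeq d} (hρ : V.IsMinimalRun ρ) : ρ ∈ B := by
  obtain ⟨σ, hσ, h⟩ := hB.2.2 ρ hρ.1
  exact (hρ.2 σ (hB.2.1 σ hσ) h).antisymm h ▸ hσ

end VASS

/-! ### Faithful runs -/

/-- Configurations only get smaller when passing to an embedded sequence, so a counter that is zero
stays zero. -/
theorem VASSFaithful.of_embeds {ρ σ : VASSStepSeq 2} (hσ : VASSFaithful σ) (h : VASSEmbeds ρ σ) :
    VASSFaithful ρ := by
  obtain ⟨f, -, hle⟩ := h
  intro s hs i hi
  obtain ⟨j, rfl⟩ := List.get_of_mem hs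
  obtain ⟨hc, ht, -⟩ := hle j
  have := hσ _ (List.get_mem σ (f j)) i (ht ▸ hi)
  exact Nat.le_zero.1 (this ▸ hc.2 i)

theorem VASS.exists_faithful_isMinimalRun_iff (V : VASS 2) :
    (∃ ρ, V.IsRun ρ ∧ VASSFaithful ρ) ↔ ∃ ρ, V.IsMinimalRun ρ ∧ VASSFaithful ρ := by
  constructor
  · rintro ⟨σ, hσ, hf⟩
    obtain ⟨ρ, hρ, h⟩ := V.exists_isMinimalRun_embeds hσ
    exact ⟨ρ, hρ, hf.of_embeds h⟩
  · rintro ⟨ρ, hρ, hf⟩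
    exact ⟨ρ, hρ.1, hf⟩

/-- Every basis contains all minimal runs, so faithful runs can be found by searching any basis. -/
theorem VASS.IsBasis.exists_faithful_iff {V : VASS 2} {B : Set (VASSStepSeq 2)}
    (hB : V.IsBasis B) : (∃ ρ ∈ B, VASSFaithful ρ) ↔ ∃ ρ, V.IsRun ρ ∧ VASSFaithful ρ := by
  constructor
  · rintro ⟨ρ, hρ, hf⟩
    exact ⟨ρ, hB.2.1 ρ hρ, hf⟩
  · rw [V.exists_faithful_isMinimalRun_iff]
    rintro ⟨ρ, hρ, hf⟩
    exact ⟨ρ, hB.mem_of_isMinimalRun hρ, hf⟩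

namespace TwoCounterMachine

theorem step_iff_exists_transition (M : TwoCounterMachine) (c c' : VASSConfig 2) :
    M.Step c c' ↔ ∃ t ∈ M.toVASS.trans, VASSFires c t c' ∧
      ∀ i : Fin 2, t.2.1 = some i.val → c.2 i = 0 := by
  constructor
  · rintro (⟨v, hv, hc⟩ | ⟨i, hi, h0, hc⟩)
    · exact ⟨(c.1, none, v, c'.1), Finset.mem_image_of_mem toVASSTransition hv, ⟨rfl, rfl, hc⟩,
        by simp⟩
    · refine ⟨(c.1, some i.val, fun _ => 0, c'.1), Finset.mem_image_of_mem toVASSTransition hi,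
        ⟨rfl, rfl, by simp [hc]⟩, fun j hj => ?_⟩
      obtain rfl : i = j := Fin.ext (by simpa using hj)
      exact h0
  · rintro ⟨t, ht, ⟨h1, h2, hc⟩, h0⟩
    obtain ⟨⟨p, o, q⟩, hm, rfl⟩ := Finset.mem_image.1 ht
    rcases o with v | i
    · simp only [toVASSTransition] at h1 h2 hc
      exact .inl ⟨v, by rwa [h1, h2], hc⟩
    · simp only [toVASSTransition] at h1 h2 hc h0
      exact .inr ⟨i, by rwa [h1, h2], h0 i rfl, funext fun j => by simpa using hc j⟩

theorem reflTransGen_step_iff (M : TwoCounterMachine) (c c' : VASSConfig 2) :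
    Relation.ReflTransGen M.Step c c' ↔ ∃ ρ, M.toVASS.IsPath c ρ c' ∧ VASSFaithful ρ := by
  constructor
  · intro h
    induction h using Relation.ReflTransGen.head_induction_on with
    | refl => exact ⟨[], rfl, by simp [VASSFaithful]⟩
    | head hs _ ih =>
      obtain ⟨ρ, hρ, hf⟩ := ih
      obtain ⟨t, ht, hfire, h0⟩ := (M.step_iff_exists_transition _ _).1 hs
      exact ⟨(_, t, _) :: ρ, ⟨rfl, ht, hfire, hρ⟩, List.forall_mem_cons.2 ⟨h0, hf⟩⟩
  · rintro ⟨ρ, hρ, hf⟩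
    induction ρ generalizing c with
    | nil => exact hρ ▸ .refl
    | cons s ρ ih =>
      obtain ⟨rfl, ht, hfire, hρ⟩ := hρ
      obtain ⟨h0, hf⟩ := List.forall_mem_cons.1 hf
      exact .head ((M.step_iff_exists_transition _ _).2 ⟨_, ht, hfire, h0⟩) (ih _ hρ hf)

theorem hasRun_iff_exists_faithful (M : TwoCounterMachine) :
    M.HasRun ↔ ∃ ρ, M.toVASS.IsRun ρ ∧ VASSFaithful ρ := by
  rw [HasRun, reflTransGen_step_iff]
  simp [VASS.IsRun, toVASS]

end TwoCounterMachine

/-! ### Structured register programs -/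

/-- Programs over registers `0, 1, 2, …` holding natural numbers. The program `loop i P` repeats,
as long as register `i` is positive: decrement register `i`, then run `P`. -/
inductive RegProg : Type
  | skip
  | inc (i : ℕ)
  | seq (P Q : RegProg)
  | loop (i : ℕ) (P : RegProg)

namespace RegProg

open Function (update)

/-- Big-step semantics: `P.Exec r r'` if `P`, started with register contents `r`, stops with
contents `r'`. -/
inductive Exec : RegProg → (ℕ → ℕ) → (ℕ → ℕ) → Prop
  | skip {r} : Exec skip r r
  | inc {i r} : Exec (inc i) r (update r i (r i + 1))
  | seq {P Q r r' r''} : Exec P r r' → Exec Q r' r'' → Exec (seq P Q) r r''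
  | loop_zero {i P r} : r i = 0 → Exec (loop i P) r r
  | loop_succ {i P r r' r'' m} : r i = m + 1 → Exec P (update r i m) r' →
      Exec (loop i P) r' r'' → Exec (loop i P) r r''

theorem Exec.skip' {r r' : ℕ → ℕ} (h : r = r') : Exec .skip r r' :=
  h ▸ .skip

theorem Exec.inc' {i : ℕ} {r r' : ℕ → ℕ} (h : r' = update r i (r i + 1)) : Exec (.inc i) r r' :=
  h ▸ .inc

/-- A loop that runs exactly `k` times: `s m` are the register contents after `m` rounds, where the
loop register holds the number of rounds left. -/
theorem Exec.loop_of_invariant {i : ℕ} {P : RegProg} (s : ℕ → ℕ → ℕ) (k : ℕ)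
    (hi : ∀ m ≤ k, s m i = k - m) (h : ∀ m < k, Exec P (update (s m) i (k - (m + 1))) (s (m + 1))) :
    Exec (.loop i P) (s 0) (s k) := by
  suffices ∀ j ≤ k, Exec (.loop i P) (s (k - j)) (s k) by simpa using this k le_rfl
  intro j hj
  induction j with
  | zero => exact .loop_zero (by simpa using hi k le_rfl)
  | succ j ih =>
    have h1 := h (k - (j + 1)) (by omega)
    have h2 : k - (j + 1) + 1 = k - j := by omega
    rw [h2] at h1
    refine .loop_succ (m := j) (by rw [hi _ (by omega)]; omega) ?_ (ih (by omega))
    convert h1 using 2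
    omega

/-- Reset register `i`. -/
def clear (i : ℕ) : RegProg := .loop i .skip

theorem exec_clear (i : ℕ) (r : ℕ → ℕ) : Exec (clear i) r (update r i 0) := by
  have := Exec.loop_of_invariant (i := i) (P := .skip) (fun m => update r i (r i - m)) (r i)
    (by simp) (fun m _ => by simpa using Exec.skip)
  simpa [clear] using this

/-- Add register `i` to register `j` and reset register `i`. -/
def move (i j : ℕ) : RegProg := .loop i (.inc j)

theorem exec_move {i j : ℕ} (hij : i ≠ j) (r : ℕ → ℕ) :
    Exec (move i j) r (update (update r i 0) j (r j + r i)) := by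
  have := Exec.loop_of_invariant (i := i) (P := .inc j)
    (fun m => update (update r i (r i - m)) j (r j + m)) (r i)
    (by simp [hij]) (fun m _ => .inc' (by
      ext x
      simp only [Function.update_apply]
      split_ifs <;> simp_all
      omega))
  simpa [move] using this

/-- Add register `i` to register `j`, with the help of register `t`. -/
def copy (i j t : ℕ) : RegProg := .seq (.loop i (.seq (.inc j) (.inc t))) (move t i)

theorem exec_copy {i j t : ℕ} (hij : i ≠ j) (hit : i ≠ t) (hjt : j ≠ t) {r : ℕ → ℕ}
    (hj : r j = 0) (ht : r t = 0) : Exec (copy i j t) r (update r j (r i)) := by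
  have := Exec.loop_of_invariant (i := i) (P := .seq (.inc j) (.inc t))
    (fun m => update (update (update r i (r i - m)) j m) t m) (r i)
    (by simp [hij, hit]) (fun m _ => .seq .inc (.inc' (by
      ext x
      simp only [Function.update_apply]
      split_ifs <;> simp_all)))
  refine .seq (r' := update (update (update r i 0) j (r i)) t (r i)) ?_ ?_
  · convert this using 1
    · ext x
      simp only [Function.update_apply]
      split_ifs <;> simp_all
    · simp
  · convert exec_move (Ne.symm hit) _ using 1
    ext x
    simp only [Function.update_apply]
    split_ifs <;> simp_all

/-- The relation `F` between argument vectors and values is computed by register programs: wherever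
the arguments are stored, and whatever base `b` beyond them is chosen, there is a program that
writes the value to register `b` and leaves all other registers as they were, provided that
initially all registers from `b` on are zero. Nothing is said about arguments without a value. -/
def Computes {n : ℕ} (F : (Fin n → ℕ) → ℕ → Prop) : Prop :=
  ∀ (a : Fin n → ℕ) (b : ℕ), (∀ i, a i < b) → ∃ P : RegProg, ∀ r : ℕ → ℕ, (∀ j, b ≤ j → r j = 0) →
    ∀ y, F (fun i => r (a i)) y → Exec P r (update r b y)

theorem Computes.mono {n : ℕ} {F G : (Fin n → ℕ) → ℕ → Prop} (hG : Computes G)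
    (h : ∀ v y, F v y → G v y) : Computes F := by
  intro a b hab
  obtain ⟨P, hP⟩ := hG a b hab
  exact ⟨P, fun r hr y hy => hP r hr y (h _ _ hy)⟩

theorem computes_zero {n : ℕ} : Computes (fun (_ : Fin n → ℕ) y => y = 0) := by
  intro a b _
  refine ⟨.skip, fun r hr y hy => .skip' ?_⟩
  rw [hy, ← hr b le_rfl, Function.update_eq_self]

theorem computes_get {n : ℕ} (i : Fin n) : Computes (fun v y => y = v i) := by
  intro a b hab
  refine ⟨copy (a i) b (b + 1), fun r hr y hy => hy ▸ ?_⟩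
  have := hab i
  exact exec_copy (by omega) (by omega) (by omega) (hr _ (by omega)) (hr _ (by omega))

theorem computes_succ : Computes (fun (v : Fin 1 → ℕ) y => y = v 0 + 1) := by
  intro a b hab
  obtain ⟨P, hP⟩ := computes_get 0 a b hab
  refine ⟨.seq P (.inc b), fun r hr y hy => .seq (hP r hr _ rfl) (.inc' ?_)⟩
  simp [hy]

/-- Registers `b, …, b + k - 1` overwritten by `w 0, …, w (k - 1)`. -/
def overwrite (r : ℕ → ℕ) (b k : ℕ) (w : ℕ → ℕ) : ℕ → ℕ :=
  fun j => if b ≤ j ∧ j < b + k then w (j - b) else r j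

theorem overwrite_zero (r : ℕ → ℕ) (b : ℕ) (w : ℕ → ℕ) : overwrite r b 0 w = r := by
  ext j
  exact if_neg (by omega)

theorem overwrite_succ (r : ℕ → ℕ) (b k : ℕ) (w : ℕ → ℕ) :
    overwrite r b (k + 1) w = update (overwrite r b k w) (b + k) (w k) := by
  ext j
  simp only [overwrite, Function.update_apply]
  split_ifs <;> first | omega | (subst_vars; simp)

/-- Reset the registers `b, …, b + k - 1`. -/
def clearRange (b : ℕ) : ℕ → RegProg
  | 0 => .skip
  | k + 1 => .seq (clear (b + k)) (clearRange b k)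

theorem exec_clearRange (b k : ℕ) {r : ℕ → ℕ} (hr : ∀ j, b ≤ j → r j = 0) (w : ℕ → ℕ) :
    Exec (clearRange b k) (overwrite r b k w) r := by
  induction k with
  | zero => exact .skip' (overwrite_zero r b w)
  | succ k ih =>
    refine .seq (exec_clear _ _) ?_
    convert ih using 1
    ext j
    simp only [overwrite, Function.update_apply]
    split_ifs <;> first | omega | simp_all

/-- Several functions of the same arguments can be evaluated into consecutive registers. -/
theorem exists_exec_overwrite {m : ℕ} (a : Fin m → ℕ) (b : ℕ) (hab : ∀ i, a i < b)
    (G : ℕ → (Fin m → ℕ) → ℕ → Prop) (k : ℕ) (hG : ∀ i < k, Computes (G i)) :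
    ∃ P : RegProg, ∀ r : ℕ → ℕ, (∀ j, b ≤ j → r j = 0) → ∀ w : ℕ → ℕ,
      (∀ i < k, G i (fun i => r (a i)) (w i)) → Exec P r (overwrite r b k w) := by
  induction k with
  | zero =>
    exact ⟨.skip, fun r _ w _ => .skip' (overwrite_zero r b w).symm⟩
  | succ k ih =>
    obtain ⟨P, hP⟩ := ih fun i hi => hG i (by omega)
    obtain ⟨Q, hQ⟩ := hG k (by omega) a (b + k) fun i => by have := hab i; omega
    refine ⟨.seq P Q, fun r hr w hw => .seq (hP r hr w fun i hi => hw i (by omega)) ?_⟩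
    rw [overwrite_succ]
    refine hQ _ (fun j hj => ?_) _ ?_
    · simp only [overwrite]
      rw [if_neg (by omega), hr _ (by omega)]
    · convert hw k (by omega) using 2 with i
      have := hab i
      simp only [overwrite]
      rw [if_neg (by omega)]

theorem Computes.comp {m n : ℕ} {F : (Fin n → ℕ) → ℕ → Prop}
    {G : Fin n → (Fin m → ℕ) → ℕ → Prop} (hF : Computes F) (hG : ∀ i, Computes (G i)) :
    Computes (fun v y => ∃ w : Fin n → ℕ, (∀ i, G i v (w i)) ∧ F w y) := by
  intro a b hab
  -- Register `b` is kept free for the result, so that it differs from the register written by `F`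
  -- even for `n = 0`.
  obtain ⟨P, hP⟩ := exists_exec_overwrite a (b + 1) (fun i => (hab i).trans (Nat.lt_succ_self b))
    (fun i v y => ∀ h : i < n, G ⟨i, h⟩ v y) n
    (fun i hi => (hG ⟨i, hi⟩).mono fun v y h => h hi)
  obtain ⟨Q, hQ⟩ := hF (fun i => b + 1 + i) (b + 1 + n) (fun i => by omega)
  refine ⟨.seq P (.seq Q (.seq (move (b + 1 + n) b) (clearRange (b + 1) n))),
    fun r hr y ⟨w, hw, hy⟩ => ?_⟩
  let w' : ℕ → ℕ := fun i => if h : i < n then w ⟨i, h⟩ else 0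
  refine .seq (hP r (fun j hj => hr j (by omega)) w' fun i hi _ => by simpa [w', hi] using hw _) ?_
  refine .seq (hQ _ (fun j hj => ?_) y ?_) ?_
  · simp only [overwrite]
    rw [if_neg (by omega), hr _ (by omega)]
  · convert hy using 1
    ext i
    simp only [overwrite, w']
    rw [if_pos (by omega)]
    simp
  refine .seq (exec_move (by omega) _) ?_
  convert exec_clearRange (b + 1) n (r := update r b y) (fun j hj => ?_) w' using 1
  · have hb := hr b le_rfl
    have hn := hr (b + 1 + n) (by omega)
    ext j
    simp only [overwrite, Function.update_apply]
    split_ifs <;> first | omega | simp_all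
  · rw [Function.update_of_ne (by omega), hr _ (by omega)]

theorem Computes.prec {n : ℕ} {f : (Fin n → ℕ) → ℕ} {g : (Fin (n + 2) → ℕ) → ℕ}
    (hf : Computes fun v y => y = f v) (hg : Computes fun v y => y = g v) :
    Computes fun (v : Fin (n + 1) → ℕ) y => y = Nat.rec (motive := fun _ => ℕ) (f (Fin.tail v))
      (fun k ih => g (Fin.cons k (Fin.cons ih (Fin.tail v)))) (v 0) := by
  intro a b hab
  -- Register `b` holds the value for the stage in register `b + 2`, and `b + 1` the number of
  -- stages to go.
  obtain ⟨P, hP⟩ := hf (Fin.tail a) b fun i => hab _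
  obtain ⟨Q, hQ⟩ := hg (Fin.cons (b + 2) (Fin.cons b (Fin.tail a))) (b + 3) (fun i => by
    refine Fin.cases ?_ (Fin.cases ?_ fun i => ?_) i
    · simp
    · simp
    · have := hab i.succ
      simp only [Fin.cons_succ, Fin.tail]
      omega)
  refine ⟨.seq P (.seq (copy (a 0) (b + 1) (b + 2)) (.seq (.loop (b + 1) (.seq Q
    (.seq (clear b) (.seq (move (b + 3) b) (.inc (b + 2)))))) (clear (b + 2)))),
    fun r hr y hy => ?_⟩
  set v : Fin (n + 1) → ℕ := fun i => r (a i) with hv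
  let val : ℕ → ℕ := fun k => Nat.rec (motive := fun _ => ℕ) (f (Fin.tail v))
    (fun k ih => g (Fin.cons k (Fin.cons ih (Fin.tail v)))) k
  have ha : ∀ i, a i ≠ b ∧ a i ≠ b + 1 ∧ a i ≠ b + 2 := fun i => by have := hab i; omega
  refine .seq (hP r hr (val 0) rfl) (.seq (exec_copy ?_ ?_ (by omega) ?_ ?_) ?_)
  · exact (ha 0).2.1
  · exact (ha 0).2.2
  · rw [Function.update_of_ne (by omega), hr _ (by omega)]
  · rw [Function.update_of_ne (by omega), hr _ (by omega)]
  have hloop := Exec.loop_of_invariant (i := b + 1)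
    (P := .seq Q (.seq (clear b) (.seq (move (b + 3) b) (.inc (b + 2)))))
    (fun m => update (update (update r b (val m)) (b + 1) (v 0 - m)) (b + 2) m) (v 0)
    (by simp) (fun m _ => by
      refine .seq (hQ _ (fun j hj => ?_) (val (m + 1)) ?_) ?_
      · rw [Function.update_of_ne (by omega), Function.update_of_ne (by omega),
          Function.update_of_ne (by omega), Function.update_of_ne (by omega), hr _ (by omega)]
      · change g _ = g _
        congr 1
        ext i
        refine Fin.cases ?_ (Fin.cases ?_ fun i => ?_) i
        · simp
        · simp [val]
        · simp [Fin.tail, ha i.succ, hv]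
      refine .seq (exec_clear _ _) (.seq (exec_move (by omega) _) (.inc' ?_))
      have h3 := hr (b + 3) (by omega)
      ext x
      simp only [Function.update_apply]
      split_ifs <;> first | omega | simp_all)
  refine .seq (r' := update (update r b (val (v 0))) (b + 2) (v 0)) ?_ ?_
  · have h1 := hr (b + 1) (by omega)
    have h2 := hr (b + 2) (by omega)
    convert hloop using 1
    · ext x
      simp only [Function.update_apply]
      split_ifs <;> simp_all
    · ext x
      simp only [Function.update_apply]
      split_ifs <;> simp_all
  · convert exec_clear (b + 2) _ using 1
    have h2 := hr (b + 2) (by omega)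
    ext x
    simp only [Function.update_apply]
    split_ifs <;> first | omega | simp_all [val]

theorem Computes.rfind {n : ℕ} {F : (Fin (n + 1) → ℕ) → ℕ → Prop} (hF : Computes F) :
    Computes fun (v : Fin n → ℕ) y =>
      F (Fin.cons y v) 0 ∧ ∀ m < y, ∃ z, F (Fin.cons m v) (z + 1) := by
  intro a b hab
  obtain ⟨P, hP⟩ := hF (Fin.cons b a) (b + 1) (fun i => by
    refine Fin.cases ?_ (fun i => ?_) i
    · simp
    · have := hab i
      simp only [Fin.cons_succ]
      omega)
  -- Register `b` is the candidate and register `b + 1` the value at it. Entering the loop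
  -- decrements that value, so the rest of it is cleared before the next evaluation.
  refine ⟨.seq P (.loop (b + 1) (.seq (clear (b + 1)) (.seq (.inc b) P))),
    fun r hr y ⟨h0, h⟩ => ?_⟩
  have ha : ∀ i, a i ≠ b := fun i => (hab i).ne
  choose! z hz using h
  let z' : ℕ → ℕ := fun m => if m < y then z m + 1 else 0
  have hz' : ∀ m ≤ y, F (Fin.cons m fun i => r (a i)) (z' m) := fun m hm => by
    rcases hm.lt_or_eq with hm | rfl
    · simpa [z', hm] using hz m hm
    · simpa [z'] using h0
  have hstep : ∀ m ≤ y, Exec P (update r b m) (update (update r b m) (b + 1) (z' m)) :=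
    fun m hm => by
      refine hP _ (fun j hj => ?_) _ ?_
      · rw [Function.update_of_ne (by omega), hr _ (by omega)]
      · convert hz' m hm using 1
        ext i
        refine Fin.cases ?_ (fun i => ?_) i
        · simp
        · simp [ha i]
  have hloop : ∀ j ≤ y, Exec (.loop (b + 1) (.seq (clear (b + 1)) (.seq (.inc b) P)))
      (update (update r b (y - j)) (b + 1) (z' (y - j))) (update r b y) := by
    intro j
    induction j with
    | zero =>
      intro _
      have : update (update r b (y - 0)) (b + 1) (z' (y - 0)) = update r b y := by
        have := hr (b + 1) (by omega)
        ext x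
        simp only [Function.update_apply, z']
        split_ifs <;> simp_all
      rw [this]
      exact .loop_zero (by rw [Function.update_of_ne (by omega), hr _ (by omega)])
    | succ j ih =>
      intro hj
      refine .loop_succ (m := z (y - (j + 1))) ?_ (.seq (exec_clear _ _) (.seq .inc ?_))
        (ih (by omega))
      · simp only [z']
        rw [if_pos (by omega)]
        simp
      · convert hstep (y - j) (by omega) using 1
        have := hr (b + 1) (by omega)
        ext x
        simp only [Function.update_apply]
        split_ifs <;> first | omega | simp_all
  have hb : update r b 0 = r := by rw [← hr b le_rfl, Function.update_eq_self]
  have h0 := hstep 0 (Nat.zero_le y)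
  have hy := hloop y le_rfl
  rw [Nat.sub_self, hb] at hy
  rw [hb] at h0
  exact .seq h0 hy

end RegProg

open Function (update)

theorem List.Vector.get_mem_of_mem_mOfFn {α : Type*} {n : ℕ} {g : Fin n → Part α}
    {w : List.Vector α n} (h : w ∈ List.Vector.mOfFn g) (i : Fin n) : w.get i ∈ g i := by
  induction n with
  | zero => exact i.elim0
  | succ n ih =>
    simp only [List.Vector.mOfFn, Part.bind_eq_bind, Part.mem_bind_iff, Part.pure_eq_some,
      Part.mem_some_iff] at h
    obtain ⟨x, hx, u, hu, rfl⟩ := h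
    refine Fin.cases ?_ (fun i => ?_) i
    · simpa using hx
    · simpa using ih hu i

namespace RegProg

theorem computes_of_primrec' {n : ℕ} {f : List.Vector ℕ n → ℕ} (hf : Nat.Primrec' f) :
    Computes fun v y => y = f (List.Vector.ofFn v) := by
  induction hf with
  | zero => exact computes_zero
  | succ => exact computes_succ.mono fun v y h => by simpa using h
  | get i => exact (computes_get i).mono fun v y h => by simpa using h
  | comp g _ _ ihf ihg =>
    exact (Computes.comp ihf ihg).mono fun v y h => ⟨_, fun i => rfl, h⟩
  | @prec n f g _ _ ihf ihg =>
    refine (Computes.prec (f := fun v => f (List.Vector.ofFn v))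
      (g := fun v => g (List.Vector.ofFn v)) ihf ihg).mono fun v y h => ?_
    simpa [List.Vector.ofFn, Fin.tail_def] using h

theorem computes_of_partrec' {n : ℕ} {f : List.Vector ℕ n →. ℕ} (hf : Nat.Partrec' f) :
    Computes fun v y => y ∈ f (List.Vector.ofFn v) := by
  induction hf with
  | prim hf => exact (computes_of_primrec' hf).mono fun v y h => by simpa using h
  | comp g _ _ ihf ihg =>
    refine (Computes.comp ihf ihg).mono fun v y h => ?_
    obtain ⟨w, hw, hy⟩ := Part.mem_bind_iff.1 h
    exact ⟨w.get, fun i => List.Vector.get_mem_of_mem_mOfFn hw i, by simpa using hy⟩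
  | @rfind n f _ ihf =>
    refine (Computes.rfind ihf).mono fun v y h => ?_
    obtain ⟨h0, hlt⟩ := Nat.mem_rfind.1 h
    refine ⟨by simpa [List.Vector.ofFn, eq_comm] using h0, fun m hm => ?_⟩
    have := hlt hm
    simp only [Part.mem_some_iff, eq_comm (a := false), decide_eq_false_iff_not] at this
    obtain ⟨z, hz⟩ := Nat.exists_eq_succ_of_ne_zero this
    exact ⟨z, by simpa [List.Vector.ofFn] using hz.symm⟩

end RegProg

/-! ### Two-counter code -/

/-- The instruction "if counter `ctr` is positive, decrement it, add `add` to the other counter and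
go to `pos`; otherwise go to `zero`". -/
structure CounterInstr where
  ctr : Fin 2
  add : ℕ
  pos : ℕ
  zero : ℕ

/-- The counter values with `m` in counter `c` and `k` in the other counter. -/
def counterPair (c : Fin 2) (m k : ℕ) : Fin 2 → ℕ := fun i => if i = c then m else k

theorem counterPair_one (m k : ℕ) : counterPair 1 m k = counterPair 0 k m := by
  ext i
  fin_cases i <;> rfl

namespace CounterInstr

/-- One step of a list of instructions; the state is the position of the current instruction. -/
inductive Step (L : List CounterInstr) : VASSConfig 2 → VASSConfig 2 → Prop
  | pos {s I} (m k : ℕ) : L[s]? = some I →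
      Step L (s, counterPair I.ctr (m + 1) k) (I.pos, counterPair I.ctr m (k + I.add))
  | zero {s I} (k : ℕ) : L[s]? = some I →
      Step L (s, counterPair I.ctr 0 k) (I.zero, counterPair I.ctr 0 k)

/-- Some number of steps of the instructions `L`. -/
abbrev Reach (L : List CounterInstr) : VASSConfig 2 → VASSConfig 2 → Prop :=
  Relation.ReflTransGen (Step L)

/-- The block `C` of instructions occurs in `L` at position `s`. -/
def CodeAt (L : List CounterInstr) (s : ℕ) (C : List CounterInstr) : Prop :=
  ∀ j < C.length, L[s + j]? = C[j]?

theorem CodeAt.append {L C D : List CounterInstr} {s : ℕ} (h : CodeAt L s (C ++ D)) :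
    CodeAt L s C ∧ CodeAt L (s + C.length) D := by
  constructor
  · intro j hj
    rw [h j (by simp; omega), List.getElem?_append_left hj]
  · intro j hj
    rw [Nat.add_assoc, h (C.length + j) (by simp; omega),
      List.getElem?_append_right (by omega)]
    simp

/-- A cycle of `p` states from position `s` on that empties counter `c`. State `j` adds `add j` to
the other counter, and is left for `exit j` when counter `c` is empty. -/
def cycle (s p : ℕ) (c : Fin 2) (add exit : ℕ → ℕ) : List CounterInstr :=
  (List.range p).map fun j => ⟨c, add j, s + (j + 1) % p, exit j⟩

theorem length_cycle (s p : ℕ) (c : Fin 2) (add exit : ℕ → ℕ) :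
    (cycle s p c add exit).length = p := by
  simp [cycle]

/-- The cycle computes any function `A` of its entry point and the value of counter `c` that
satisfies the recursion given by one turn. -/
theorem CodeAt.reach_cycle {L : List CounterInstr} {s p : ℕ} {c : Fin 2} {add exit : ℕ → ℕ}
    (h : CodeAt L s (cycle s p c add exit)) (A : ℕ → ℕ → ℕ) (hA₀ : ∀ j < p, A j 0 = 0)
    (hA : ∀ j < p, ∀ m, A j (m + 1) = add j + A ((j + 1) % p) m) (m : ℕ) :
    ∀ j < p, ∀ k, Reach L (s + j, counterPair c m k)
      (exit ((j + m) % p), counterPair c 0 (k + A j m)) := by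
  induction m with
  | zero =>
    intro j hj k
    have hI := h j (by rwa [length_cycle])
    rw [cycle, List.getElem?_map, List.getElem?_range hj, Option.map_some] at hI
    rw [hA₀ j hj, Nat.add_zero, Nat.add_zero, Nat.mod_eq_of_lt hj]
    exact .single (.zero k hI)
  | succ m ih =>
    intro j hj k
    have hI := h j (by rwa [length_cycle])
    rw [cycle, List.getElem?_map, List.getElem?_range hj, Option.map_some] at hI
    refine .head (.pos m k hI) ?_
    convert ih ((j + 1) % p) (Nat.mod_lt _ (by omega)) (k + add j) using 3
    · rw [Nat.mod_add_mod]
      congr 1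
      omega
    · rw [hA j hj, Nat.add_assoc]

theorem CodeAt.reach_mul {L : List CounterInstr} {s a e : ℕ} {c : Fin 2}
    (h : CodeAt L s (cycle s 1 c (fun _ => a) fun _ => e)) (m k : ℕ) :
    Reach L (s, counterPair c m k) (e, counterPair c 0 (k + a * m)) :=
  h.reach_cycle (fun _ m => a * m) (by simp) (fun _ _ m => by ring) m 0 one_pos k

theorem CodeAt.reach_mod {L : List CounterInstr} {s p : ℕ} {exit : ℕ → ℕ} (hp : 0 < p)
    (h : CodeAt L s (cycle s p 0 (fun _ => 1) exit)) (m : ℕ) :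
    Reach L (s, counterPair 0 m 0) (exit (m % p), counterPair 1 m 0) := by
  rw [counterPair_one]
  simpa using h.reach_cycle (fun _ m => m) (by simp) (fun _ _ m => by ring) m 0 hp 0

theorem CodeAt.reach_div {L : List CounterInstr} {s p e : ℕ} (hp : 0 < p)
    (h : CodeAt L s (cycle s p 1 (fun j => if j + 1 = p then 1 else 0) fun _ => e)) (m : ℕ) :
    Reach L (s, counterPair 1 (p * m) 0) (e, counterPair 0 m 0) := by
  have := h.reach_cycle (fun j m => (j + m) / p) (fun _ hj => Nat.div_eq_of_lt hj)
    (fun j hj m => ?_) (p * m) 0 hp 0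
  · simpa [counterPair_one, hp] using this
  · by_cases hj' : j + 1 = p
    · subst hj'
      rw [if_pos rfl, Nat.mod_self, Nat.zero_add, show j + (m + 1) = m + (j + 1) by ring,
        Nat.add_div_right _ hp, Nat.add_comm]
    · rw [if_neg hj', Nat.mod_eq_of_lt (by omega), Nat.zero_add]
      congr 1
      ring

end CounterInstr

/-! ### Compiling register programs -/

/-- The Gödel number `∏ pᵢ ^ r i` of the registers below `k`, where `pᵢ` is the `i`-th prime. -/
noncomputable def registerCode (k : ℕ) (r : ℕ → ℕ) : ℕ :=
  ∏ i ∈ Finset.range k, Nat.nth Nat.Prime i ^ r i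

theorem registerCode_update {k i : ℕ} (hi : i < k) (r : ℕ → ℕ) (m : ℕ) :
    registerCode k (update r i m) =
      Nat.nth Nat.Prime i ^ m * ∏ j ∈ Finset.range k \ {i}, Nat.nth Nat.Prime j ^ r j := by
  rw [registerCode, ← Finset.mul_prod_erase _ _ (Finset.mem_range.2 hi),
    Finset.sdiff_singleton_eq_erase]
  congr 1
  · simp
  · refine Finset.prod_congr rfl fun j hj => ?_
    rw [Function.update_of_ne (Finset.ne_of_mem_erase hj)]

theorem registerCode_update_succ {k i : ℕ} (hi : i < k) (r : ℕ → ℕ) (m : ℕ) :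
    registerCode k (update r i (m + 1)) =
      Nat.nth Nat.Prime i * registerCode k (update r i m) := by
  rw [registerCode_update hi, registerCode_update hi]
  ring

theorem registerCode_mod_eq_zero_iff {k i : ℕ} (hi : i < k) (r : ℕ → ℕ) :
    registerCode k r % Nat.nth Nat.Prime i = 0 ↔ r i ≠ 0 := by
  rw [← Nat.dvd_iff_mod_eq_zero, registerCode, (Nat.prime_nth_prime i).prime.dvd_finsetProd_iff]
  constructor
  · rintro ⟨j, -, hj⟩ h0
    have hd := (Nat.prime_nth_prime i).dvd_of_dvd_pow hj
    rw [Nat.prime_dvd_prime_iff_eq (Nat.prime_nth_prime i) (Nat.prime_nth_prime j)] at hd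
    have := Nat.nth_injective Nat.infinite_setOfPred_prime hd
    subst this
    rw [h0, pow_zero] at hj
    exact (Nat.prime_nth_prime i).one_lt.ne' (Nat.dvd_one.1 hj)
  · exact fun h => ⟨i, Finset.mem_range.2 hi, dvd_pow_self _ h⟩

namespace RegProg

open CounterInstr

/-- A strict upper bound on the registers that occur in a program. -/
def bound : RegProg → ℕ
  | skip => 0
  | inc i => i + 1
  | seq P Q => max P.bound Q.bound
  | loop i P => max (i + 1) P.bound

/-- The number of instructions of the compiled program. -/
noncomputable def codeSize : RegProg → ℕ
  | skip => 0
  | inc _ => 2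
  | seq P Q => P.codeSize + Q.codeSize
  | loop i P => 2 * Nat.nth Nat.Prime i + 2 + P.codeSize

/-- Two-counter code for a program, to be placed at position `s`. Counter `0` holds the Gödel number
of the registers, and counter `1` is zero between the simulated operations. Entry is at position
`s`, exit at position `s + codeSize`. -/
noncomputable def compile : RegProg → ℕ → List CounterInstr
  | skip, _ => []
  | inc i, s =>
      cycle s 1 0 (fun _ => Nat.nth Nat.Prime i) (fun _ => s + 1) ++
        cycle (s + 1) 1 1 (fun _ => 1) fun _ => s + 2
  | seq P Q, s => P.compile s ++ Q.compile (s + P.codeSize)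
  | loop i P, s =>
      let p := Nat.nth Nat.Prime i
      -- Move the Gödel number to counter `1`, computing its residue modulo `p`.
      cycle s p 0 (fun _ => 1) (fun j => if j = 0 then s + p + 1 else s + p) ++
      -- Register `i` is zero: move the number back and exit.
      (cycle (s + p) 1 1 (fun _ => 1) (fun _ => s + (2 * p + 2 + P.codeSize)) ++
      -- Register `i` is positive: divide by `p` while moving the number back.
      (cycle (s + p + 1) p 1 (fun j => if j + 1 = p then 1 else 0) (fun _ => s + p + 1 + p) ++
      (P.compile (s + p + 1 + p) ++
      -- Counter `1` is zero here, so this is a jump.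
      cycle (s + p + 1 + p + P.codeSize) 1 1 (fun _ => 1) fun _ => s)))

theorem length_compile (P : RegProg) (s : ℕ) : (P.compile s).length = P.codeSize := by
  induction P generalizing s with
  | skip => rfl
  | inc i => simp [compile, codeSize, length_cycle]
  | seq P Q ihP ihQ => simp [compile, codeSize, ihP, ihQ]
  | loop i P ih =>
    simp only [compile, codeSize, List.length_append, length_cycle, ih]
    omega

theorem Exec.reach_compile {P : RegProg} {r r' : ℕ → ℕ} (h : Exec P r r')
    {L : List CounterInstr} {s k : ℕ} (hk : P.bound ≤ k) (hL : CodeAt L s (P.compile s)) :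
    Reach L (s, counterPair 0 (registerCode k r) 0)
      (s + P.codeSize, counterPair 0 (registerCode k r') 0) := by
  induction h generalizing s with
  | skip => exact .refl
  | @inc i r =>
    obtain ⟨h₁, h₂⟩ := hL.append
    rw [length_cycle] at h₂
    refine (h₁.reach_mul _ _).trans ?_
    rw [← counterPair_one]
    have := h₂.reach_mul (Nat.nth Nat.Prime i * registerCode k r) 0
    rw [counterPair_one 0, Nat.zero_add, Nat.one_mul] at this
    rw [Nat.zero_add]
    rwa [registerCode_update_succ hk, Function.update_eq_self]
  | @seq P Q r r' r'' _ _ ihP ihQ =>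
    obtain ⟨h₁, h₂⟩ := hL.append
    rw [length_compile] at h₂
    have := (ihP ((le_max_left _ _).trans hk) h₁).trans (ihQ ((le_max_right _ _).trans hk) h₂)
    rwa [Nat.add_assoc] at this
  | @loop_zero i P r h0 =>
    have hp := (Nat.prime_nth_prime i).pos
    have hi : i < k := (le_max_left _ _).trans hk
    obtain ⟨h₁, h⟩ := hL.append
    rw [length_cycle] at h
    obtain ⟨h₂, -⟩ := h.append
    refine (h₁.reach_mod hp _).trans ?_
    rw [if_neg (by rw [registerCode_mod_eq_zero_iff hi]; simpa using h0)]
    have := h₂.reach_mul (registerCode k r) 0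
    rwa [counterPair_one 0, Nat.zero_add, Nat.one_mul] at this
  | @loop_succ i P r r' r'' m hm _ _ ihP ihL =>
    have hp := (Nat.prime_nth_prime i).pos
    have hi : i < k := (le_max_left _ _).trans hk
    obtain ⟨h₁, h⟩ := hL.append
    rw [length_cycle] at h
    obtain ⟨-, h⟩ := h.append
    rw [length_cycle] at h
    obtain ⟨h₃, h⟩ := h.append
    rw [length_cycle] at h
    obtain ⟨h₄, h₅⟩ := h.append
    rw [length_compile] at h₅
    refine (h₁.reach_mod hp _).trans ?_
    rw [if_pos (by rw [registerCode_mod_eq_zero_iff hi]; omega)]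
    have hr : registerCode k r = Nat.nth Nat.Prime i * registerCode k (update r i m) := by
      rw [← registerCode_update_succ hi, ← hm, Function.update_eq_self]
    rw [hr]
    refine (h₃.reach_div hp _).trans ((ihP ((le_max_right _ _).trans hk) h₄).trans ?_)
    refine .trans ?_ (ihL hk hL)
    rw [← counterPair_one]
    simpa using h₅.reach_mul 0 (registerCode k r')

end RegProg

/-! ### Two-counter machines with an input -/

namespace CounterInstr

/-- The transitions of a two-counter machine that execute the instruction at position `s`. -/
def transitions (s : ℕ) (I : CounterInstr) : List (ℕ × ((Fin 2 → ℤ) ⊕ Fin 2) × ℕ) :=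
  [(s, Sum.inl fun i => if i = I.ctr then -1 else I.add, I.pos), (s, Sum.inr I.ctr, I.zero)]

/-- The transitions for all instructions of a list. -/
def codeTransitions (L : List CounterInstr) : List (ℕ × ((Fin 2 → ℤ) ⊕ Fin 2) × ℕ) :=
  L.zipIdx.flatMap fun x => transitions x.2 x.1

theorem mem_codeTransitions {L : List CounterInstr} {t : ℕ × ((Fin 2 → ℤ) ⊕ Fin 2) × ℕ} :
    t ∈ codeTransitions L ↔ ∃ s I, L[s]? = some I ∧ t ∈ transitions s I := by
  simp only [codeTransitions, List.mem_flatMap, List.mem_zipIdx_iff_getElem?, Prod.exists]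
  exact exists_comm

/-- The counter update that puts `x` into counter `0`. -/
def inputVector (x : ℕ) : Fin 2 → ℤ := fun i => if i = 0 then x else 0

/-- The transition that writes the input `x` and enters the code at position `0`. -/
def inputTransition (start x : ℕ) : ℕ × ((Fin 2 → ℤ) ⊕ Fin 2) × ℕ :=
  (start, Sum.inl (inputVector x), 0)

/-- The states of a machine with code `L`: the start and target states, the entry of the code and
the ends of all its transitions. -/
def codeStates (L : List CounterInstr) : List ℕ :=
  (L.length + 2) :: L.length :: 0 :: (codeTransitions L).flatMap fun t => [t.1, t.2.2]

/-- The machine that writes the number `x` to counter `0` and then executes the code `L`. Its target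
is the first position after the code; the position after that has no transitions either and serves
as a dead end; the one after the dead end is the start state. Only the update of one transition
depends on `x`. -/
def inputMachine (L : List CounterInstr) (x : ℕ) : TwoCounterMachine where
  states := (codeStates L).toFinset
  start := L.length + 2
  trans := (inputTransition (L.length + 2) x :: codeTransitions L).toFinset
  target := L.length
  start_mem := by simp [codeStates]
  trans_mem := by
    intro q o q' h
    rw [List.mem_toFinset, List.mem_cons] at h
    rcases h with h | h
    · simp only [inputTransition, Prod.mk.injEq] at h
      simp [codeStates, h]
    · simp only [List.mem_toFinset, codeStates, List.mem_cons, List.mem_flatMap]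
      exact ⟨.inr (.inr (.inr ⟨_, h, by simp⟩)), .inr (.inr (.inr ⟨_, h, by simp⟩))⟩
  target_mem := by simp [codeStates]

theorem mem_trans_inputMachine {L : List CounterInstr} {x : ℕ}
    {t : ℕ × ((Fin 2 → ℤ) ⊕ Fin 2) × ℕ} : t ∈ (inputMachine L x).trans ↔
      t = inputTransition (L.length + 2) x ∨ ∃ s I, L[s]? = some I ∧ t ∈ transitions s I := by
  rw [inputMachine, List.mem_toFinset, List.mem_cons, mem_codeTransitions]

theorem Step.step_inputMachine {L : List CounterInstr} {c c' : VASSConfig 2} (h : Step L c c')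
    (x : ℕ) : (inputMachine L x).Step c c' := by
  cases h with
  | @pos s I m k hI =>
    refine .inl ⟨_, mem_trans_inputMachine.2 (.inr ⟨s, I, hI, List.mem_cons_self⟩), fun i => ?_⟩
    by_cases hi : i = I.ctr <;> simp [counterPair, hi]
  | @zero s I k hI =>
    refine .inr ⟨_, mem_trans_inputMachine.2 (.inr ⟨s, I, hI, by simp [transitions]; rfl⟩), ?_, rfl⟩
    simp [counterPair]

theorem step_start_inputMachine (L : List CounterInstr) (x : ℕ) :
    (inputMachine L x).Step (L.length + 2, fun _ => 0) (0, counterPair 0 x 0) := by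
  refine .inl ⟨_, mem_trans_inputMachine.2 (.inl rfl), fun i => ?_⟩
  by_cases hi : i = 0 <;> simp [counterPair, inputVector, hi]

theorem step_inputMachine_cases {L : List CounterInstr} {x : ℕ} {c c' : VASSConfig 2}
    (h : (inputMachine L x).Step c c') :
    (c.1 = L.length + 2 ∧ c'.1 = 0 ∧ ∀ i, (c'.2 i : ℤ) = c.2 i + inputVector x i) ∨
    ∃ I, L[c.1]? = some I ∧
      ((c'.1 = I.pos ∧ ∀ i, (c'.2 i : ℤ) = c.2 i + if i = I.ctr then -1 else (I.add : ℤ)) ∨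
        (c'.1 = I.zero ∧ c.2 I.ctr = 0 ∧ c'.2 = c.2)) := by
  rcases h with ⟨v, hm, hv⟩ | ⟨i, hm, h0, hc⟩
  · rcases mem_trans_inputMachine.1 hm with h | ⟨s, I, hI, h⟩
    · simp only [inputTransition, Prod.mk.injEq, Sum.inl.injEq] at h
      obtain ⟨h1, rfl, h2⟩ := h
      exact .inl ⟨h1, h2, hv⟩
    · simp only [transitions, List.mem_cons, Prod.mk.injEq, Sum.inl.injEq, List.not_mem_nil,
        reduceCtorEq, false_and, and_false, or_false] at h
      obtain ⟨h1, rfl, h2⟩ := h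
      exact .inr ⟨I, h1 ▸ hI, .inl ⟨h2, hv⟩⟩
  · rcases mem_trans_inputMachine.1 hm with h | ⟨s, I, hI, h⟩
    · simp [inputTransition] at h
    · simp only [transitions, List.mem_cons, Prod.mk.injEq, Sum.inr.injEq, List.not_mem_nil,
        reduceCtorEq, false_and, and_false, or_false, false_or] at h
      obtain ⟨h1, rfl, h2⟩ := h
      exact .inr ⟨I, h1 ▸ hI, .inr ⟨h2, h0, hc⟩⟩

/-- The machine is deterministic: the two transitions of an instruction exclude each other, and the
start state lies outside the code. -/
theorem step_inputMachine_unique {L : List CounterInstr} {x : ℕ} {c c₁ c₂ : VASSConfig 2}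
    (h₁ : (inputMachine L x).Step c c₁) (h₂ : (inputMachine L x).Step c c₂) : c₁ = c₂ := by
  have hnone : ∀ {I : CounterInstr}, c.1 = L.length + 2 → L[c.1]? ≠ some I := fun h hI => by
    rw [h, List.getElem?_eq_none (by omega)] at hI
    cases hI
  rcases step_inputMachine_cases h₁ with ⟨hc, hq, hv⟩ | ⟨I, hI, hs⟩ <;>
    rcases step_inputMachine_cases h₂ with ⟨hc', hq', hv'⟩ | ⟨I', hI', hs'⟩
  · exact Prod.ext (hq.trans hq'.symm) (funext fun i => by have := hv i; have := hv' i; omega)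
  · exact absurd hI' (hnone hc)
  · exact absurd hI (hnone hc')
  obtain rfl : I = I' := Option.some.inj (hI.symm.trans hI')
  rcases hs with ⟨hq, hv⟩ | ⟨hq, h0, hv⟩ <;> rcases hs' with ⟨hq', hv'⟩ | ⟨hq', h0', hv'⟩
  · exact Prod.ext (hq.trans hq'.symm) (funext fun i => by have := hv i; have := hv' i; omega)
  · have := hv I.ctr
    rw [if_pos rfl] at this
    omega
  · have := hv' I.ctr
    rw [if_pos rfl] at this
    omega
  · exact Prod.ext (hq.trans hq'.symm) (hv.trans hv'.symm)

theorem not_step_inputMachine {L : List CounterInstr} {x : ℕ} {c c' : VASSConfig 2}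
    (h : L.length ≤ c.1) (h' : c.1 < L.length + 2) : ¬ (inputMachine L x).Step c c' := by
  intro hs
  rcases step_inputMachine_cases hs with ⟨hc, -⟩ | ⟨I, hI, -⟩
  · omega
  · rw [List.getElem?_eq_none h] at hI
    cases hI

theorem Reach.reflTransGen_inputMachine {L : List CounterInstr} {x : ℕ} {c : VASSConfig 2}
    (h : Reach L (0, counterPair 0 x 0) c) :
    Relation.ReflTransGen (inputMachine L x).Step (L.length + 2, fun _ => 0) c :=
  .head (step_start_inputMachine L x) (h.lift id fun _ _ hs => hs.step_inputMachine x)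

theorem hasRun_inputMachine {L : List CounterInstr} {x : ℕ}
    (h : Reach L (0, counterPair 0 x 0) (L.length, fun _ => 0)) : (inputMachine L x).HasRun :=
  h.reflTransGen_inputMachine

/-- A deterministic machine that gets stuck outside its target never reaches the target. -/
theorem not_hasRun_inputMachine {L : List CounterInstr} {x : ℕ} {u : Fin 2 → ℕ}
    (h : Reach L (0, counterPair 0 x 0) (L.length + 1, u)) : ¬ (inputMachine L x).HasRun := by
  intro hrun
  have huniq : Relator.RightUnique (inputMachine L x).Step :=
    fun _ _ _ h₁ h₂ => step_inputMachine_unique h₁ h₂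
  have hne : (L.length, fun _ => 0) ≠ (L.length + 1, u) := fun he => by
    have := congrArg Prod.fst he
    simp at this
  rcases Relation.ReflTransGen.total_of_right_unique huniq hrun h.reflTransGen_inputMachine with
    h' | h'
  · rcases h'.cases_head with he | ⟨c, hs, -⟩
    · exact hne he
    · exact not_step_inputMachine le_rfl (Nat.lt_add_of_pos_right two_pos) hs
  · rcases h'.cases_head with he | ⟨c, hs, -⟩
    · exact hne he.symm
    · exact not_step_inputMachine (by simp) (by simp) hs

end CounterInstr

namespace RegProg

open CounterInstr

/-- The compiled program `P`, followed by a test of register `1`: if it is zero, the counters are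
emptied and the code is left for the position after its end; otherwise it is left for the position
after that one. -/
noncomputable def testCode (P : RegProg) : List CounterInstr :=
  let S := P.codeSize
  let p := Nat.nth Nat.Prime 1
  P.compile 0 ++ (cycle S p 0 (fun _ => 1) (fun j => if j = 0 then S + p + 2 else S + p) ++
    cycle (S + p) 1 1 (fun _ => 0) fun _ => S + p + 1)

theorem length_testCode (P : RegProg) :
    P.testCode.length = P.codeSize + Nat.nth Nat.Prime 1 + 1 := by
  simp [testCode, length_compile, length_cycle, Nat.add_assoc]

theorem Exec.reach_testCode {P : RegProg} {r r' : ℕ → ℕ} (h : Exec P r r') :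
    (r' 1 = 0 → Reach P.testCode (0, counterPair 0 (registerCode (max P.bound 2) r) 0)
      (P.testCode.length, fun _ => 0)) ∧
    (r' 1 ≠ 0 → ∃ u, Reach P.testCode (0, counterPair 0 (registerCode (max P.bound 2) r) 0)
      (P.testCode.length + 1, u)) := by
  have hL : CodeAt P.testCode 0 P.testCode := fun j _ => by rw [Nat.zero_add]
  obtain ⟨h₁, h₂⟩ := hL.append
  rw [length_compile, Nat.zero_add] at h₂
  obtain ⟨h₂, h₃⟩ := h₂.append
  rw [length_cycle] at h₃
  have h1 : 1 < max P.bound 2 := lt_max_of_lt_right one_lt_two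
  have hP := h.reach_compile (le_max_left _ 2) h₁
  rw [Nat.zero_add] at hP
  have hreach := hP.trans (h₂.reach_mod (Nat.prime_nth_prime 1).pos _)
  have hmod := registerCode_mod_eq_zero_iff h1 r'
  rw [length_testCode]
  constructor
  · intro h0
    rw [if_neg (by rw [hmod]; simpa using h0)] at hreach
    refine hreach.trans ?_
    have hzero : (fun _ => 0) = counterPair 1 0 0 := funext fun i => (ite_self 0).symm
    rw [hzero]
    simpa using h₃.reach_mul (registerCode (max P.bound 2) r') 0
  · intro h0
    rw [if_pos (hmod.2 h0)] at hreach
    exact ⟨_, hreach⟩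

end RegProg

/-- Every partial recursive function `f` is tested for the value zero by fixed two-counter code on
inputs `2 ^ n`. -/
theorem exists_code_of_partrec {f : ℕ →. ℕ} (hf : Partrec f) :
    ∃ L : List CounterInstr, ∀ n,
      (0 ∈ f n → (CounterInstr.inputMachine L (2 ^ n)).HasRun) ∧
      (1 ∈ f n → ¬ (CounterInstr.inputMachine L (2 ^ n)).HasRun) := by
  obtain ⟨P, hP⟩ := RegProg.computes_of_partrec' (Nat.Partrec'.part_iff₁.2 hf) (fun _ => 0) 1
    (fun _ => one_pos)
  refine ⟨P.testCode, fun n => ?_⟩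
  have hexec : ∀ y ∈ f n, P.Exec (update 0 0 n) (update (update 0 0 n) 1 y) := fun y hy =>
    hP _ (fun j hj => by rw [Function.update_of_ne (by omega)]; rfl) y (by simpa using hy)
  have hcode : registerCode (max P.bound 2) (update 0 0 n) = 2 ^ n := by
    rw [registerCode_update (lt_max_of_lt_right two_pos)]
    simp [Nat.nth_prime_zero_eq_two]
  constructor
  · intro h
    have := (hexec 0 h).reach_testCode.1 (by simp)
    rw [hcode] at this
    exact CounterInstr.hasRun_inputMachine this
  · intro h
    obtain ⟨u, hu⟩ := (hexec 1 h).reach_testCode.2 (by simp)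
    rw [hcode] at hu
    exact CounterInstr.not_hasRun_inputMachine hu

/-! ### Undecidability -/

/-- Diagonal argument: the code `L` belongs to the function that runs the program with number `n`
on input `n`, and a decision procedure would be a program that errs on its own number. -/
theorem exists_code_not_computablePred : ∃ L : List CounterInstr,
    ¬ ComputablePred fun n => (CounterInstr.inputMachine L (2 ^ n)).HasRun := by
  have hf : Partrec fun n : ℕ => Nat.Partrec.Code.eval (Denumerable.ofNat Nat.Partrec.Code n) n :=
    Nat.Partrec.Code.eval_part.comp (Computable.ofNat _) Computable.id
  obtain ⟨L, hL⟩ := exists_code_of_partrec hf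
  refine ⟨L, fun h => ?_⟩
  obtain ⟨hdec, hcomp⟩ := h
  obtain ⟨c, hc⟩ := Nat.Partrec.Code.exists_code.1 (Partrec.nat_iff.1
    (Computable.cond hcomp (Computable.const 1) (Computable.const 0)).partrec)
  have hn := hL (Encodable.encode c)
  rw [Denumerable.ofNat_encode, hc] at hn
  by_cases hrun : (CounterInstr.inputMachine L (2 ^ Encodable.encode c)).HasRun
  · exact hn.2 (by simp [hrun]) hrun
  · exact hrun (hn.1 (by simp [hrun]))

/-- A description of the VASS of the machine with input `x`. -/
def CounterInstr.inputDescription (L : List CounterInstr) (x : ℕ) : VASSDescription 2 :=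
  (codeStates L, [0, 1],
    (inputTransition (L.length + 2) x :: codeTransitions L).map TwoCounterMachine.toVASSTransition,
    [L.length + 2], [L.length])

theorem CounterInstr.isDescribedBy_inputDescription (L : List CounterInstr) (x : ℕ) :
    (inputMachine L x).toVASS.IsDescribedBy (inputDescription L x) := by
  refine ⟨rfl, rfl, ?_, rfl, rfl⟩
  ext t
  simp [inputDescription, TwoCounterMachine.toVASS, inputMachine]

theorem Primrec.int_natCast : Primrec (fun n : ℕ => (n : ℤ)) :=
  Primrec.encode_iff.1 ((Primrec.nat_mul.comp (Primrec.const 2) Primrec.id).of_eq fun _ => rfl)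

theorem CounterInstr.primrec_inputVector : Primrec inputVector :=
  Primrec.fin_curry.2 (Primrec.ite (Primrec.eq.comp Primrec.snd (Primrec.const 0))
    (Primrec.int_natCast.comp Primrec.fst) (Primrec.const 0))

theorem CounterInstr.primrec_inputDescription (L : List CounterInstr) :
    Primrec (inputDescription L) := by
  have ht : Primrec fun x =>
      TwoCounterMachine.toVASSTransition (inputTransition (L.length + 2) x) :=
    (Primrec.const (L.length + 2)).pair ((Primrec.const none).pair
      (primrec_inputVector.pair (Primrec.const 0)))
  exact (Primrec.const _).pair ((Primrec.const _).pair ((Primrec.list_cons.comp ht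
    (Primrec.const _)).pair ((Primrec.const _).pair (Primrec.const _))))

theorem primrecPred_vassFaithful : PrimrecPred VASSFaithful := by
  have hstep : ∀ i : Fin 2, PrimrecPred
      fun s : VASSConfig 2 × VASSTransition 2 × VASSConfig 2 =>
        s.2.1.2.1 = some i.val → s.1.2 i = 0 := fun i => by
    have hlabel : Primrec fun s : VASSConfig 2 × VASSTransition 2 × VASSConfig 2 => s.2.1.2.1 :=
      Primrec.fst.comp (Primrec.snd.comp (Primrec.fst.comp Primrec.snd))
    have hctr : Primrec fun s : VASSConfig 2 × VASSTransition 2 × VASSConfig 2 => s.1.2 i :=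
      Primrec.fin_app.comp (Primrec.snd.comp Primrec.fst) (Primrec.const i)
    exact ((Primrec.eq.comp hlabel (Primrec.const _)).not.or
      (Primrec.eq.comp hctr (Primrec.const 0))).of_eq fun s => imp_iff_not_or.symm
  refine (((hstep 0).and (hstep 1)).forall_mem_list).of_eq fun ρ => ?_
  simp only [VASSFaithful, Fin.forall_fin_two]

/-- An algorithm that produces bases would decide whether a two-counter machine has a run, by
searching the basis for a faithful run. -/
theorem not_exists_partrec_isBasis :
    ¬ ∃ f : VASSDescription 2 →. List (VASSStepSeq 2), Partrec f ∧
      ∀ (V : VASS 2) (c : VASSDescription 2), V.IsDescribedBy c →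
        ∃ B ∈ f c, V.IsBasis {ρ | ρ ∈ B} := by
  rintro ⟨f, hf, hbasis⟩
  obtain ⟨L, hL⟩ := exists_code_not_computablePred
  choose B hB hBbasis using fun n => hbasis _ _
    (CounterInstr.isDescribedBy_inputDescription L (2 ^ n))
  have hpow : Primrec fun n : ℕ => 2 ^ n :=
    (Primrec₂.unpaired'.1 Nat.Primrec.pow).comp (Primrec.const 2) Primrec.id
  have hBcomp : Computable B :=
    (hf.comp ((CounterInstr.primrec_inputDescription L).comp hpow).to_comp).of_eq
      fun n => Part.eq_some_iff.2 (hB n)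
  obtain ⟨hdec, hpred⟩ := primrecPred_vassFaithful.exists_mem_list
  refine hL (ComputablePred.computable_iff.2 ⟨_, hpred.to_comp.comp hBcomp, ?_⟩)
  ext n
  rw [TwoCounterMachine.hasRun_iff_exists_faithful, ← (hBbasis n).exists_faithful_iff]
  simp

theorem not_exists_partrec_isMinimalRun :
    ¬ ∃ f : VASSDescription 2 →. List (VASSStepSeq 2), Partrec f ∧
      ∀ (V : VASS 2) (c : VASSDescription 2), V.IsDescribedBy c →
        ∃ B ∈ f c, ∀ ρ, ρ ∈ B ↔ V.IsMinimalRun ρ := by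
  rintro ⟨f, hf, hmin⟩
  refine not_exists_partrec_isBasis ⟨f, hf, fun V c hc => ?_⟩
  obtain ⟨B, hB, h⟩ := hmin V c hc
  exact ⟨B, hB, by simpa only [h] using V.isBasis_setOf_isMinimalRun⟩

theorem mainTheorem11 :
    (∀ V : VASS 2,
      IsPartialOrder {ρ : VASSStepSeq 2 // V.IsRun ρ} (fun ρ σ => VASSEmbeds ρ.1 σ.1) ∧
      WellQuasiOrdered (fun ρ σ : {ρ : VASSStepSeq 2 // V.IsRun ρ} => VASSEmbeds ρ.1 σ.1) ∧
      V.IsBasis {ρ | V.IsMinimalRun ρ}) ∧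
    (∀ M : TwoCounterMachine,
      (M.HasRun ↔ ∃ ρ, M.toVASS.IsRun ρ ∧ VASSFaithful ρ) ∧
      ((∃ ρ, M.toVASS.IsRun ρ ∧ VASSFaithful ρ) ↔
        ∃ ρ, M.toVASS.IsMinimalRun ρ ∧ VASSFaithful ρ)) ∧
    (¬ ∃ f : VASSDescription 2 →. List (VASSStepSeq 2), Partrec f ∧
      ∀ (V : VASS 2) (c : VASSDescription 2), V.IsDescribedBy c →
        ∃ B ∈ f c, V.IsBasis {ρ | ρ ∈ B}) ∧
    (¬ ∃ f : VASSDescription 2 →. List (VASSStepSeq 2), Partrec f ∧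
      ∀ (V : VASS 2) (c : VASSDescription 2), V.IsDescribedBy c →
        ∃ B ∈ f c, ∀ ρ, ρ ∈ B ↔ V.IsMinimalRun ρ) :=
  ⟨fun V => ⟨V.isPartialOrder_embeds, V.wellQuasiOrdered_embeds, V.isBasis_setOf_isMinimalRun⟩,
    fun M => ⟨M.hasRun_iff_exists_faithful, M.toVASS.exists_faithful_isMinimalRun_iff⟩,
    not_exists_partrec_isBasis, not_exists_partrec_isMinimalRun⟩
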